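/- Let $n\ge 1$ and $D\ge 0$. Let $\mathcal S^D$ be the set of functions $\zeta:[0,\infty]\to[0,\infty]$ for which there is a nondecreasing $\varsigma:[0,\infty]\to[0,\infty]$ with $\varsigma(r)>0$ for $r>0$ and $$\lim_{r\to 0+}\frac{\varsigma(\lambda r)}{\varsigma(r)}=\lambda^D\qquad\text{for every }\lambda>0,$$ such that for every $\varepsilon>0$ the inequalities $\zeta\le(1+\varepsilon)\varsigma$ and $\varsigma\le(1+\varepsilon)\zeta$ hold on some neighbourhood of $0$ in $[0,\infty]$. For $\zeta\in\mathcal S^D$ let $k_\zeta$ be the (Borel regular, metric) outer measure on Euclidean space $\mathbb R^n$ given by $$k_\zeta(A)=\sup_{\delta>0}\ \inf\Big\{\sum_{S\in\mathcal C}\zeta(\operatorname{diam}S)\ :\ \mathcal C\text{ a countable cover of }A\text{ by sets of diameter}\le\delta\Big\}$$ (finite and empty families count as countable), regarded as a measure. Let $O',O\subseteq\mathbb R^n$ be open and let $\Phi$ be a conformal map from $O'$ onto $O$, i.e. a bijection $O'\to O$ that is differentiable at every $x\in O'$ with $\Phi'(x)$ a nonzero multiple of a linear isometry; let $J(\Phi)(x)=\det\Phi'(x)$.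 Let $\zeta\in\mathcal S^D$. Then for every $k_\zeta|_O$-integrable function $f$ on $O$ (with values in $\mathbb R$, $\mathbb C$ or any real Banach space), the function $x\mapsto\big(\sqrt[n]{|J(\Phi)(x)|}\big)^{D} f(\Phi(x))$ is $k_\zeta|_{O'}$-integrable and $$\int_O f(y)\,k_\zeta(dy)=\int_{O'} f(\Phi(x))\Big(\sqrt[n]{|J(\Phi)(x)|}\Big)^{D}\,k_\zeta(dx).$$ -/

import Mathlib

open MeasureTheory Filter Topology Set
open scoped ENNReal NNReal

noncomputable section

namespace GenHausdorff

section Comparison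

variable {I : Type*}

/-- For `[0, ∞]`-valued functions `f`, `g` with filters `F`, `G` on the same set, the comparison
constant of `(f, F)` and `(g, G)`: the infimum over `U ∈ G` of the constants `r` such that `f ≤ r g`
on `U` if `F` is contained in `G` (as families of sets, which is `G ≤ F` in the order on filters),
and `∞` otherwise. -/
def ell (f : I → ℝ≥0∞) (F : Filter I) (g : I → ℝ≥0∞) (G : Filter I) : ℝ≥0∞ :=
  open Classical in
  if G ≤ F then ⨅ U ∈ G, ⨅ (r : ℝ≥0) (_ : ∀ x ∈ U, f x ≤ r * g x), (r : ℝ≥0∞) else ∞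

/-- The relation "`ℓ ≤ 1` in both directions". -/
def AsympEq (f : I → ℝ≥0∞) (F : Filter I) (g : I → ℝ≥0∞) (G : Filter I) : Prop :=
  ell f F g G ≤ 1 ∧ ell g G f F ≤ 1

end Comparison

/-- A monotone gauge of scale dimension `D`: nondecreasing, positive on `(0, ∞]`, and
`ς (lam * r) / ς r → lam ^ D` as `r → 0`, `r > 0`, for every `lam > 0`. -/
structure IsScaleGauge (D : ℝ) (ς : ℝ≥0∞ → ℝ≥0∞) : Prop where
  mono : Monotone ς
  pos : ∀ r, 0 < r → 0 < ς r
  tendsto : ∀ lam : ℝ≥0, 0 < lam →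
    Tendsto (fun r : ℝ≥0∞ => ς (lam * r) / ς r) (𝓝[>] 0) (𝓝 ((lam : ℝ≥0∞) ^ D))

/-- The class `𝒮^D`: functions on `[0, ∞]`, carrying the filter of neighbourhoods of `0`, that are
asymptotically equal to a monotone gauge of scale dimension `D`. -/
def scaleClass (D : ℝ) : Set (ℝ≥0∞ → ℝ≥0∞) :=
  {η | ∃ ς, IsScaleGauge D ς ∧ AsympEq η (𝓝 0) ς (𝓝 0)}

section Caratheodory

variable {X : Type*}

/-- The outer measure `A ↦ inf ∑ ζ S`, the infimum over the countable (possibly finite or empty)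
covers of `A` by members of `U`. -/
def coverOuter (ζ : Set X → ℝ≥0∞) (U : Set (Set X)) : OuterMeasure X where
  measureOf A := ⨅ (C : Set (Set X)) (_ : C.Countable) (_ : C ⊆ U) (_ : A ⊆ ⋃₀ C), ∑' S : C, ζ S
  empty := by
    refine le_antisymm ?_ bot_le
    refine (iInf_le_of_le ∅ <| iInf_le_of_le countable_empty <|
      iInf_le_of_le (empty_subset _) <| iInf_le_of_le (empty_subset _) ?_)
    simp
  mono := by
    intro A B hAB
    refine le_iInf fun C => le_iInf fun hc => le_iInf fun hU => le_iInf fun hB => ?_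
    exact iInf_le_of_le C <| iInf_le_of_le hc <| iInf_le_of_le hU <|
      iInf_le_of_le (hAB.trans hB) le_rfl
  iUnion_nat := by
    intro s _
    refine ENNReal.le_of_forall_pos_le_add fun ε hε hfin => ?_
    obtain ⟨ε', hε', hsum⟩ :=
      ENNReal.exists_pos_sum_of_countable (ENNReal.coe_pos.2 hε).ne' ℕ
    have hlt : ∀ i, ∃ C : Set (Set X), C.Countable ∧ C ⊆ U ∧ s i ⊆ ⋃₀ C ∧
        ∑' S : C, ζ S ≤ (⨅ (C : Set (Set X)) (_ : C.Countable) (_ : C ⊆ U) (_ : s i ⊆ ⋃₀ C),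
          ∑' S : C, ζ S) + ε' i := by
      intro i
      have hne := ENNReal.ne_top_of_tsum_ne_top hfin.ne i
      have := ENNReal.lt_add_right hne (ENNReal.coe_pos.2 (hε' i)).ne'
      simp only [iInf_lt_iff] at this
      obtain ⟨C, hc, hU, hs, h⟩ := this
      exact ⟨C, hc, hU, hs, h.le⟩
    choose C hc hU hs hC using hlt
    refine iInf_le_of_le (⋃ i, C i) <| iInf_le_of_le (countable_iUnion hc) <|
      iInf_le_of_le (iUnion_subset hU) <| iInf_le_of_le ?_ ?_
    · refine iUnion_subset fun i => (hs i).trans ?_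
      exact sUnion_subset_sUnion (subset_iUnion C i)
    · calc ∑' S : ↥(⋃ i, C i), ζ S ≤ ∑' i, ∑' S : C i, ζ S := ENNReal.tsum_iUnion_le_tsum ζ C
        _ ≤ ∑' i, (_ + (ε' i : ℝ≥0∞)) := ENNReal.tsum_le_tsum hC
        _ = _ := ENNReal.tsum_add
        _ ≤ _ := by gcongr

/-- The Carathéodory construction for a set function `ζ` and a filter `F` on the subsets of `X`. -/
def caratheodory (ζ : Set X → ℝ≥0∞) (F : Filter (Set X)) : OuterMeasure X :=
  ⨆ U ∈ F, coverOuter ζ U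

theorem caratheodory_apply (ζ : Set X → ℝ≥0∞) (F : Filter (Set X)) (A : Set X) :
    caratheodory ζ F A = ⨆ U ∈ F, ⨅ (C : Set (Set X)) (_ : C.Countable) (_ : C ⊆ U)
      (_ : A ⊆ ⋃₀ C), ∑' S : C, ζ S := by
  simp only [caratheodory, OuterMeasure.iSup_apply]
  rfl

end Caratheodory

section Metric

variable {X : Type*} [EMetricSpace X]

variable (X) in
/-- The filter on subsets of `X` generated by the families `{S | diam S ≤ ε}`, `ε > 0`, i.e. the
preimage of the neighbourhood filter of `0` under the diameter. -/
def smallSets : Filter (Set X) := comap Metric.ediam (𝓝 0)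

/-- The outer measure `k_ζ` on a metric space: the Carathéodory construction applied to
`S ↦ ζ (diam S)` and the filter of small sets. -/
def outer (ζ : ℝ≥0∞ → ℝ≥0∞) : OuterMeasure X :=
  caratheodory (fun S => ζ (Metric.ediam S)) (smallSets X)

theorem outer_eq_mkMetric (ζ : ℝ≥0∞ → ℝ≥0∞) :
    (outer ζ : OuterMeasure X) = OuterMeasure.mkMetric ζ := by
  have key : ∀ U ∈ smallSets X, ∃ r > 0, {S : Set X | Metric.ediam S ≤ r} ⊆ U := by
    intro U hU
    obtain ⟨V, hV, hVU⟩ := hU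
    obtain ⟨r, hr, hrV⟩ := (ENNReal.nhds_zero_basis_Iic).mem_iff.1 hV
    exact ⟨r, hr, fun S hS => hVU (hrV hS)⟩
  refine le_antisymm ?_ ?_
  · refine iSup₂_le fun U hU => ?_
    obtain ⟨r, hr, hrU⟩ := key U hU
    refine le_trans ?_ (le_iSup₂ (f := fun r (_ : r > 0) =>
      OuterMeasure.mkMetric'.pre (fun S : Set X => ζ (Metric.ediam S)) r) r hr)
    rw [OuterMeasure.mkMetric'.le_pre]
    intro S hS
    refine iInf_le_of_le {S} <| iInf_le_of_le (countable_singleton S) <|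
      iInf_le_of_le (singleton_subset_iff.2 (hrU hS)) <| iInf_le_of_le (by simp) ?_
    simp
  · refine iSup₂_le fun r hr => ?_
    have hmem : {S : Set X | Metric.ediam S ≤ r} ∈ smallSets X :=
      ⟨Iic r, Iic_mem_nhds hr, fun S hS => hS⟩
    refine le_trans ?_ (le_iSup₂ (f := fun U (_ : U ∈ smallSets X) =>
      coverOuter (fun S : Set X => ζ (Metric.ediam S)) U) _ hmem)
    intro A
    refine le_iInf fun C => le_iInf fun hc => le_iInf fun hU => le_iInf fun hA => ?_
    refine (measure_mono hA).trans ?_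
    rw [sUnion_eq_biUnion]
    refine (measure_biUnion_le _ hc _).trans ?_
    exact ENNReal.tsum_le_tsum fun S => OuterMeasure.mkMetric'.pre_le (hU S.2)

theorem le_caratheodory_outer [MeasurableSpace X] [BorelSpace X] (ζ : ℝ≥0∞ → ℝ≥0∞) :
    ‹MeasurableSpace X› ≤ (outer ζ : OuterMeasure X).caratheodory := by
  rw [outer_eq_mkMetric]
  exact (OuterMeasure.mkMetric'_isMetric _).le_caratheodory

/-- The outer measure `k_ζ` as a Borel measure. -/
def measure [MeasurableSpace X] [BorelSpace X] (ζ : ℝ≥0∞ → ℝ≥0∞) : Measure X :=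
  (outer ζ).toMeasure (le_caratheodory_outer ζ)

end Metric

/-- `Φ` is a conformal map from `O'` onto `O`: a bijection of `O'` onto `O` whose derivative exists
at each point of `O'` and is a nonzero multiple of a linear isometry. -/
structure IsConformalOnto {E : Type*} [NormedAddCommGroup E] [NormedSpace ℝ E]
    (Φ : E → E) (O' O : Set E) : Prop where
  bijOn : BijOn Φ O' O
  conformalAt : ∀ x ∈ O', ConformalAt Φ x

end GenHausdorff

end

/-!
The measure `k_ζ` depends on `ζ` only up to asymptotic equality, so `ζ` may be replaced by a
monotone gauge `ς` of scale dimension `D`. For such a gauge, a `b`-Lipschitz map enlarges the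
measure at most by the factor `b ^ D`: it enlarges diameters at most by `b`, and
`ς (b * r) / ς r → b ^ D`.

Let `Φ` be injective with a measurable pointwise dilation factor `c > 0`, and let `q > 1`. The
domain splits into countably many measurable pieces, on each of which `Φ` is bi-Lipschitz with
constants `a` and `q * a` and `c` lies between `a` and `q * a`. On such a piece the measure of the
image and the integral of `c ^ D` agree up to the factor `q ^ D`. Summing over the pieces and
letting `q → 1` gives `k_ς (Φ '' s) = ∫⁻ x in s, c x ^ D`, which is the transformation rule for
indicator functions. The dilation factor of a conformal map is the norm of its derivative, hence
the root of the absolute value of the Jacobian determinant.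
-/

open Function Module

noncomputable section

namespace GenHausdorff

section Comparison

theorem eventually_le_mul_of_ell_le_one {I : Type*} {f g : I → ℝ≥0∞} {F G : Filter I}
    (h : ell f F g G ≤ 1) {q : ℝ≥0} (hq : 1 < q) : ∀ᶠ x in G, f x ≤ q * g x := by
  unfold ell at h
  split_ifs at h with hFG
  · have hlt := h.trans_lt (ENNReal.coe_lt_coe.2 hq)
    simp only [iInf_lt_iff] at hlt
    obtain ⟨U, hU, r, hr, hrq⟩ := hlt
    filter_upwards [hU] with x hx
    exact (hr x hx).trans (by gcongr)
  · simp at h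

theorem le_of_forall_one_lt_le_rpow_mul {D : ℝ} {x y : ℝ≥0∞}
    (h : ∀ q : ℝ≥0, 1 < q → x ≤ (q : ℝ≥0∞) ^ D * y) : x ≤ y := by
  have hpow : Tendsto (fun q : ℝ≥0 => (q : ℝ≥0∞) ^ D) (𝓝[>] 1) (𝓝 1) :=
    ((ENNReal.continuous_rpow_const.comp ENNReal.continuous_coe).tendsto' 1 1
      (by simp)).mono_left nhdsWithin_le_nhds
  have hlim : Tendsto (fun q : ℝ≥0 => (q : ℝ≥0∞) ^ D * y) (𝓝[>] 1) (𝓝 y) := by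
    simpa using ENNReal.Tendsto.mul_const hpow (Or.inl one_ne_zero)
  exact ge_of_tendsto hlim (eventually_nhdsWithin_of_forall h)

theorem le_of_forall_one_lt_le_mul {x y : ℝ≥0∞} (h : ∀ q : ℝ≥0, 1 < q → x ≤ q * y) : x ≤ y :=
  le_of_forall_one_lt_le_rpow_mul (D := 1) (by simpa using h)

end Comparison

namespace IsScaleGauge

variable {D : ℝ} {ς : ℝ≥0∞ → ℝ≥0∞}

theorem dim_nonneg (h : IsScaleGauge D ς) : 0 ≤ D := by
  by_contra! hD
  have hhalf : ((2⁻¹ : ℝ≥0) : ℝ≥0∞) < 1 := by exact_mod_cast two_inv_lt_one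
  have hratio : ∀ r : ℝ≥0∞, ς ((2⁻¹ : ℝ≥0) * r) / ς r ≤ 1 := fun r =>
    (ENNReal.div_le_div_right (h.mono (mul_le_of_le_one_left' hhalf.le)) _).trans
      ENNReal.div_self_le_one
  exact (ENNReal.one_lt_rpow_of_pos_of_lt_one_of_neg (by simp) hhalf hD).not_ge
    (le_of_tendsto' (h.tendsto 2⁻¹ (by positivity)) hratio)

theorem eventually_ne_top (h : IsScaleGauge D ς) : ∀ᶠ r in 𝓝[>] 0, ς r ≠ ∞ := by
  filter_upwards [(h.tendsto 1 one_pos).eventually_ne (b₂ := 0) (by simp)] with r hr htop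
  simp [htop] at hr

/- If `ς` had a positive limit at `0+`, then the limit of `ς (lam * r) / ς r` would be `1` for every
`lam`. -/
theorem apply_zero (h : IsScaleGauge D ς) (hD : 0 < D) : ς 0 = 0 := by
  set m := sInf (ς '' Ioi 0)
  have hlim : Tendsto ς (𝓝[>] 0) (𝓝 m) := h.mono.tendsto_nhdsGT 0
  have hle : ς 0 ≤ m := le_sInf (forall_mem_image.2 fun r _ => h.mono zero_le)
  have hm_top : m ≠ ∞ := by
    obtain ⟨r, hr, hr0⟩ := (h.eventually_ne_top.and self_mem_nhdsWithin).exists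
    exact ne_top_of_le_ne_top hr (sInf_le (mem_image_of_mem ς hr0))
  have hscale : Tendsto (fun r : ℝ≥0∞ => (2⁻¹ : ℝ≥0) * r) (𝓝[>] 0) (𝓝[>] 0) := by
    refine tendsto_nhdsWithin_iff.2 ⟨?_, ?_⟩
    · exact ((ENNReal.continuous_const_mul ENNReal.coe_ne_top).tendsto' 0 0
        (mul_zero _)).mono_left nhdsWithin_le_nhds
    · filter_upwards [self_mem_nhdsWithin] with r hr
      exact ENNReal.mul_pos (by simp) (ne_of_gt hr)
  by_contra h0
  have hm : m ≠ 0 := fun hm => h0 (le_zero_iff.1 (hm ▸ hle))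
  have hone := ENNReal.Tendsto.div (hlim.comp hscale) (Or.inl hm) hlim (Or.inl hm_top)
  rw [ENNReal.div_self hm hm_top] at hone
  have hlt : ((2⁻¹ : ℝ≥0) : ℝ≥0∞) ^ D < 1 :=
    ENNReal.rpow_lt_one (by exact_mod_cast two_inv_lt_one) hD
  exact hlt.ne (tendsto_nhds_unique (h.tendsto 2⁻¹ (by positivity)) hone)

theorem eventually_nhdsGT_le (h : IsScaleGauge D ς) {b : ℝ≥0} (hb : 0 < b)
    {t : ℝ≥0∞} (ht : (b : ℝ≥0∞) ^ D < t) : ∀ᶠ r in 𝓝[>] 0, ς (b * r) ≤ t * ς r := by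
  filter_upwards [(h.tendsto b hb).eventually (gt_mem_nhds ht), h.eventually_ne_top,
    self_mem_nhdsWithin] with r hr hfin h0
  exact (ENNReal.div_le_iff (h.pos r h0).ne' hfin).1 hr.le

theorem eventually_le (h : IsScaleGauge D ς) {b : ℝ≥0} (hb : 0 < b) {q : ℝ≥0} (hq : 1 < q) :
    ∀ᶠ r in 𝓝 0, ς (b * r) ≤ q * (b : ℝ≥0∞) ^ D * ς r := by
  have hq' : (1 : ℝ≥0∞) < q := by exact_mod_cast hq
  have hbD : (b : ℝ≥0∞) ^ D < q * (b : ℝ≥0∞) ^ D := by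
    simpa using ENNReal.mul_lt_mul_left (by simp [hb.ne']) (by simp [h.dim_nonneg]) hq'
  filter_upwards [eventually_nhdsWithin_iff.1 (h.eventually_nhdsGT_le hb hbD)] with r hr
  rcases eq_or_ne r 0 with rfl | hr0
  · rcases h.dim_nonneg.eq_or_lt with rfl | hD
    · simpa using le_mul_of_one_le_left' hq'.le
    · simp [h.apply_zero hD]
  · exact hr (pos_iff_ne_zero.2 hr0)

end IsScaleGauge

section Metric

variable {X Y : Type*} [EMetricSpace X] [MeasurableSpace X] [BorelSpace X]
  [EMetricSpace Y] [MeasurableSpace Y] [BorelSpace Y]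

theorem measure_eq_mkMetric (ζ : ℝ≥0∞ → ℝ≥0∞) :
    (measure ζ : Measure X) = Measure.mkMetric ζ := by
  unfold measure Measure.mkMetric
  congr 1
  exact outer_eq_mkMetric ζ

theorem measure_le_of_ell_le_one {ζ ς : ℝ≥0∞ → ℝ≥0∞} (h : ell ζ (𝓝 0) ς (𝓝 0) ≤ 1) :
    (measure ζ : Measure X) ≤ measure ς := by
  rw [measure_eq_mkMetric, measure_eq_mkMetric]
  refine Measure.le_iff'.2 fun s => le_of_forall_one_lt_le_mul fun q hq => ?_
  exact Measure.mkMetric_mono_smul ENNReal.coe_ne_top (by simpa using (zero_lt_one.trans hq).ne')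
    ((eventually_le_mul_of_ell_le_one h hq).filter_mono nhdsWithin_le_nhds) s

theorem AsympEq.measure_eq {ζ ς : ℝ≥0∞ → ℝ≥0∞} (h : AsympEq ζ (𝓝 0) ς (𝓝 0)) :
    (measure ζ : Measure X) = measure ς :=
  le_antisymm (measure_le_of_ell_le_one h.1) (measure_le_of_ell_le_one h.2)

theorem mkMetric_image_le {m : ℝ≥0∞ → ℝ≥0∞} (hm : Monotone m) {b : ℝ≥0} {f : X → Y} {s : Set X}
    (hf : LipschitzOnWith b f s) :
    Measure.mkMetric m (f '' s) ≤ Measure.mkMetric (fun r => m (b * r)) s := by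
  have hdiam : ∀ t : Set X, Metric.ediam (f '' (t ∩ s)) ≤ b * Metric.ediam t := fun t => by
    simpa using hf.holderOnWith.ediam_image_inter_le t
  simp only [Measure.mkMetric_apply]
  refine iSup₂_le fun R hR => ?_
  have hlim : Tendsto (fun d : ℝ≥0∞ => b * d) (𝓝 0) (𝓝 0) :=
    (ENNReal.continuous_const_mul ENNReal.coe_ne_top).tendsto' 0 0 (mul_zero _)
  obtain ⟨δ, hδ, hδR⟩ :=
    ENNReal.nhds_zero_basis_Iic.eventually_iff.1 (hlim.eventually (gt_mem_nhds hR))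
  refine le_iSup₂_of_le δ hδ <| le_iInf₂ fun t hst => le_iInf fun htδ => ?_
  refine iInf₂_le_of_le (fun n => f '' (t n ∩ s)) ?_ <|
    iInf_le_of_le (fun n => (hdiam (t n)).trans (hδR (htδ n)).le) ?_
  · rw [← image_iUnion, ← iUnion_inter, inter_eq_self_of_subset_right hst]
  · refine ENNReal.tsum_le_tsum fun n => iSup_le fun hne => ?_
    exact le_iSup_of_le (image_nonempty.1 hne).left (hm (hdiam (t n)))

namespace IsScaleGauge

variable {D : ℝ} {ς : ℝ≥0∞ → ℝ≥0∞} {f : X → Y} {s : Set X}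

theorem measure_image_le (h : IsScaleGauge D ς) {b : ℝ≥0} (hb : 0 < b)
    (hf : LipschitzOnWith b f s) : measure ς (f '' s) ≤ (b : ℝ≥0∞) ^ D * measure ς s := by
  rw [measure_eq_mkMetric, measure_eq_mkMetric]
  refine le_of_forall_one_lt_le_mul fun q hq => ?_
  have hq0 : q ≠ 0 := (zero_lt_one.trans hq).ne'
  rw [← mul_assoc]
  calc Measure.mkMetric ς (f '' s) ≤ Measure.mkMetric (fun r => ς (b * r)) s :=
        mkMetric_image_le h.mono hf
    _ ≤ (q * (b : ℝ≥0∞) ^ D) * Measure.mkMetric ς s :=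
        Measure.mkMetric_mono_smul
          (ENNReal.mul_ne_top ENNReal.coe_ne_top (by simp [h.dim_nonneg])) (by simp [hb.ne', hq0])
          ((h.eventually_le hb hq).filter_mono nhdsWithin_le_nhds) s

theorem le_measure_image (h : IsScaleGauge D ς) {a : ℝ≥0} (ha : 0 < a)
    (hf : ∀ x ∈ s, ∀ y ∈ s, a * edist x y ≤ edist (f x) (f y)) :
    (a : ℝ≥0∞) ^ D * measure ς s ≤ measure ς (f '' s) := by
  rcases s.eq_empty_or_nonempty with rfl | ⟨x₀, -⟩
  · simp
  have : Nonempty X := ⟨x₀⟩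
  have ha' : (a : ℝ≥0∞) ≠ 0 := by simpa using ha.ne'
  have hinj : InjOn f s := fun x hx y hy hxy => by
    simpa [hxy, ha'] using hf x hx y hy
  have hinv : LeftInvOn (invFunOn f s) f s := hinj.leftInvOn_invFunOn
  have hlip : LipschitzOnWith a⁻¹ (invFunOn f s) (f '' s) := by
    rintro _ ⟨x, hx, rfl⟩ _ ⟨y, hy, rfl⟩
    rw [hinv hx, hinv hy, ENNReal.coe_inv ha.ne', mul_comm, ← div_eq_mul_inv,
      ENNReal.le_div_iff_mul_le (Or.inl ha') (Or.inl ENNReal.coe_ne_top), mul_comm]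
    exact hf x hx y hy
  have hle := h.measure_image_le (inv_pos.2 ha) hlip
  rw [hinv.image_image, ENNReal.coe_inv ha.ne', ENNReal.inv_rpow, mul_comm,
    ← div_eq_mul_inv] at hle
  rw [mul_comm]
  exact ENNReal.mul_le_of_le_div hle

end IsScaleGauge

end Metric

section Dilation

variable {X Y : Type*} [MetricSpace X] [MetricSpace Y] {Φ : X → Y} {c : X → ℝ≥0} {s t : Set X}
  {a b q : ℝ≥0}

/-- `c x` is the pointwise dilation factor at `x` of the restriction of `Φ` to `s`, for each point
`x` of `s`. Nothing is required at an isolated point of `s`. -/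
def HasDilationOn (Φ : X → Y) (c : X → ℝ≥0) (s : Set X) : Prop :=
  ∀ x ∈ s, Tendsto (fun y => nndist (Φ x) (Φ y) / nndist x y) (𝓝[s \ {x}] x) (𝓝 (c x))

/-- `Φ` is bi-Lipschitz on `s` with lower constant `a` and upper constant `b`. -/
def BilipschitzOn (a b : ℝ≥0) (Φ : X → Y) (s : Set X) : Prop :=
  ∀ x ∈ s, ∀ y ∈ s, nndist (Φ x) (Φ y) ∈ Icc (a * nndist x y) (b * nndist x y)

/-- The set of the points `x` of `s` such that `Φ` changes the distance from `x` to the points of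
`s` closer to `x` than `r` by factors between `a` and `b`. These sets serve to make the limits in
`HasDilationOn` uniform on measurable pieces. -/
def bilipschitzLocus (a b : ℝ≥0) (Φ : X → Y) (s : Set X) (r : ℝ) : Set X :=
  {x ∈ s | ∀ y ∈ s, dist x y < r → nndist (Φ x) (Φ y) ∈ Icc (a * nndist x y) (b * nndist x y)}

/-- On `s`, the map `Φ` is a similarity, and the function `c` its ratio, up to the factor `q`. -/
def IsNearSimilarityOn (q : ℝ≥0) (Φ : X → Y) (c : X → ℝ≥0) (s : Set X) : Prop :=
  ∃ a > 0, BilipschitzOn a (q * a) Φ s ∧ MapsTo c s (Icc a (q * a))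

theorem BilipschitzOn.mono (h : BilipschitzOn a b Φ s) (hts : t ⊆ s) : BilipschitzOn a b Φ t :=
  fun x hx y hy => h x (hts hx) y (hts hy)

theorem BilipschitzOn.lipschitzOnWith (h : BilipschitzOn a b Φ s) : LipschitzOnWith b Φ s :=
  fun x hx y hy => by simpa only [edist_nndist] using mod_cast (h x hx y hy).2

theorem BilipschitzOn.mul_edist_le (h : BilipschitzOn a b Φ s) :
    ∀ x ∈ s, ∀ y ∈ s, a * edist x y ≤ edist (Φ x) (Φ y) :=
  fun x hx y hy => by simpa only [edist_nndist] using mod_cast (h x hx y hy).1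

theorem IsNearSimilarityOn.mono (h : IsNearSimilarityOn q Φ c s) (hts : t ⊆ s) :
    IsNearSimilarityOn q Φ c t :=
  let ⟨a, ha, hbil, hca⟩ := h
  ⟨a, ha, hbil.mono hts, hca.mono_left hts⟩

theorem bilipschitzOn_bilipschitzLocus_inter_ball (a b : ℝ≥0) (Φ : X → Y) (s : Set X) (r : ℝ)
    (z : X) : BilipschitzOn a b Φ (bilipschitzLocus a b Φ s r ∩ Metric.ball z (r / 2)) := by
  rintro x ⟨hx, hxz⟩ y ⟨hy, hyz⟩
  refine hx.2 y hy.1 ?_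
  calc dist x y ≤ dist x z + dist y z := dist_triangle_right x y z
    _ < r / 2 + r / 2 := add_lt_add hxz hyz
    _ = r := add_halves r

theorem measurableSet_bilipschitzLocus [MeasurableSpace X] [OpensMeasurableSpace X]
    (hs : MeasurableSet s) (hΦ : ContinuousOn Φ s) (a b : ℝ≥0) (r : ℝ) :
    MeasurableSet (bilipschitzLocus a b Φ s r) := by
  have hcont : Continuous fun x : s => Φ x := continuousOn_iff_continuous_domRestrict.1 hΦ
  have hclosed : IsClosed {x : s | ∀ y : s, dist (x : X) y < r →
      nndist (Φ x) (Φ y) ∈ Icc (a * nndist (x : X) y) (b * nndist (x : X) y)} := by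
    simp only [ofPred_forall, imp_iff_not_or, not_lt, mem_Icc]
    refine isClosed_iInter fun y => ?_
    have hdist : Continuous fun x : s => nndist (x : X) y := by fun_prop
    have hdistΦ : Continuous fun x : s => nndist (Φ x) (Φ y) := hcont.nndist continuous_const
    have hfar : IsClosed {x : s | r ≤ dist (x : X) y} := isClosed_le continuous_const (by fun_prop)
    exact hfar.union
      ((isClosed_le (continuous_const.mul hdist) hdistΦ).and
        (isClosed_le hdistΦ (continuous_const.mul hdist)))
  convert! hs.subtype_image hclosed.measurableSet using 1
  ext x
  simp [bilipschitzLocus, and_comm]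

namespace HasDilationOn

theorem mono (h : HasDilationOn Φ c s) (hts : t ⊆ s) : HasDilationOn Φ c t := fun x hx =>
  (h x (hts hx)).mono_left (nhdsWithin_mono x (sdiff_subset_sdiff_left hts))

theorem continuousOn (h : HasDilationOn Φ c s) : ContinuousOn Φ s := by
  intro x hx
  rw [← continuousWithinAt_sdiff_self, ContinuousWithinAt, tendsto_iff_dist_tendsto_zero]
  have hdist : Tendsto (fun y => nndist x y) (𝓝[s \ {x}] x) (𝓝 0) :=
    ((continuous_const.nndist continuous_id).tendsto' x 0 (nndist_self x)).mono_left
      nhdsWithin_le_nhds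
  have hprod := NNReal.tendsto_coe.2 ((h x hx).mul hdist)
  rw [mul_zero] at hprod
  refine hprod.congr' ?_
  filter_upwards [self_mem_nhdsWithin] with y hy
  have hxy : nndist x y ≠ 0 := nndist_eq_zero.not.2 (Ne.symm hy.2)
  rw [div_mul_cancel₀ _ hxy, coe_nndist, dist_comm]

theorem exists_mem_bilipschitzLocus (h : HasDilationOn Φ c s) {x : X} (hx : x ∈ s)
    (ha : a < c x) (hb : c x < b) : ∃ j : ℕ, x ∈ bilipschitzLocus a b Φ s (1 / (j + 1)) := by
  have hev := eventually_nhdsWithin_iff.1 ((h x hx).eventually (Ioo_mem_nhds ha hb))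
  obtain ⟨ε, hε, hball⟩ := Metric.eventually_nhds_iff.1 hev
  obtain ⟨j, hj⟩ := exists_nat_one_div_lt hε
  refine ⟨j, hx, fun y hy hxy => ?_⟩
  rcases eq_or_ne y x with rfl | hyx
  · simp
  · have hpos : 0 < nndist x y := pos_iff_ne_zero.2 (nndist_eq_zero.not.2 hyx.symm)
    obtain ⟨hlow, hup⟩ := hball (by rw [dist_comm]; exact hxy.trans hj) ⟨hy, hyx⟩
    exact ⟨((lt_div_iff₀ hpos).1 hlow).le, ((div_lt_iff₀ hpos).1 hup).le⟩

variable [MeasurableSpace X] [OpensMeasurableSpace X] [SecondCountableTopology X]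

theorem exists_cover_isNearSimilarityOn (h : HasDilationOn Φ c s) (hs : MeasurableSet s)
    (hc : Measurable c) (hpos : ∀ x ∈ s, 0 < c x) (hq : 1 < q) :
    ∃ P : ℕ → Set X, (∀ i, MeasurableSet (P i)) ∧ s ⊆ ⋃ i, P i ∧
      ∀ i, IsNearSimilarityOn q Φ c (P i) := by
  rcases s.eq_empty_or_nonempty with rfl | ⟨x₀, -⟩
  · exact ⟨fun _ => ∅, fun _ => .empty, empty_subset _, fun _ =>
      ⟨1, one_pos, fun x hx => hx.elim, mapsTo_empty c _⟩⟩
  have : Nonempty X := ⟨x₀⟩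
  let ratio : ℕ → Ioi (0 : ℝ≥0) := TopologicalSpace.denseSeq _
  let center : ℕ → X := TopologicalSpace.denseSeq X
  let piece : ℕ × ℕ × ℕ → Set X := fun ⟨j, k, l⟩ =>
    bilipschitzLocus (ratio l) (q * ratio l) Φ s (1 / (j + 1)) ∩
      Metric.ball (center k) (1 / (j + 1) / 2) ∩ c ⁻¹' Icc (ratio l) (q * ratio l)
  obtain ⟨e, he⟩ := exists_surjective_nat (ℕ × ℕ × ℕ)
  refine ⟨fun i => piece (e i), fun i => ?_, fun x hx => ?_, fun i => ?_⟩
  · exact ((measurableSet_bilipschitzLocus hs h.continuousOn _ _ _).inter measurableSet_ball).inter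
      (hc measurableSet_Icc)
  · have hq0 : 0 < q := zero_lt_one.trans hq
    let lower : Ioi (0 : ℝ≥0) := ⟨c x / q, div_pos (hpos x hx) hq0⟩
    let upper : Ioi (0 : ℝ≥0) := ⟨c x, hpos x hx⟩
    obtain ⟨_, ⟨l, rfl⟩, hlow, hup⟩ := (TopologicalSpace.denseRange_denseSeq
      (Ioi (0 : ℝ≥0))).exists_between (show lower < upper from div_lt_self (hpos x hx) hq)
    have hratio : ratio l < c x := hup
    have hratio' : c x < q * ratio l := (div_lt_iff₀' hq0).1 hlow
    obtain ⟨j, hj⟩ := h.exists_mem_bilipschitzLocus hx hratio hratio'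
    obtain ⟨k, hk⟩ := (TopologicalSpace.denseRange_denseSeq X).exists_dist_lt x
      (show (0 : ℝ) < 1 / (j + 1) / 2 by positivity)
    obtain ⟨i, hi⟩ := he (j, k, l)
    exact mem_iUnion.2 ⟨i, by rw [hi]; exact ⟨⟨hj, hk⟩, hratio.le, hratio'.le⟩⟩
  · exact ⟨ratio (e i).2.2, (ratio (e i).2.2).2,
      (bilipschitzOn_bilipschitzLocus_inter_ball _ _ Φ s _ _).mono inter_subset_left,
      fun x hx => hx.2⟩

theorem exists_partition_isNearSimilarityOn (h : HasDilationOn Φ c s) (hs : MeasurableSet s)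
    (hc : Measurable c) (hpos : ∀ x ∈ s, 0 < c x) (hq : 1 < q) :
    ∃ T : ℕ → Set X, (∀ i, MeasurableSet (T i)) ∧ Pairwise (Disjoint on T) ∧ ⋃ i, T i = s ∧
      ∀ i, IsNearSimilarityOn q Φ c (T i) := by
  obtain ⟨P, hPm, hsP, hP⟩ := h.exists_cover_isNearSimilarityOn hs hc hpos hq
  refine ⟨fun i => s ∩ disjointed P i, fun i => hs.inter (.disjointed hPm i), fun i j hij =>
    (disjoint_disjointed P hij).mono inter_subset_right inter_subset_right, ?_, fun i => ?_⟩
  · rwa [← inter_iUnion, iUnion_disjointed, inter_eq_left]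
  · exact (hP i).mono (inter_subset_right.trans (disjointed_subset P i))

end HasDilationOn

end Dilation

namespace IsScaleGauge

variable {X Y : Type*} [MetricSpace X] [MeasurableSpace X] [BorelSpace X]
  [MetricSpace Y] [MeasurableSpace Y] [BorelSpace Y] {Φ : X → Y} {c : X → ℝ≥0} {s : Set X}
  {D : ℝ} {ς : ℝ≥0∞ → ℝ≥0∞} {q : ℝ≥0}

theorem measure_image_le_rpow_mul_lintegral (h : IsScaleGauge D ς) (hq : 0 < q)
    (hs : MeasurableSet s) (hΦ : IsNearSimilarityOn q Φ c s) :
    measure ς (Φ '' s) ≤ (q : ℝ≥0∞) ^ D * ∫⁻ x in s, (c x : ℝ≥0∞) ^ D ∂measure ς := by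
  have hD := h.dim_nonneg
  obtain ⟨a, ha, hbil, hca⟩ := hΦ
  calc measure ς (Φ '' s) ≤ ((q * a : ℝ≥0) : ℝ≥0∞) ^ D * measure ς s :=
        h.measure_image_le (mul_pos hq ha) hbil.lipschitzOnWith
    _ = (q : ℝ≥0∞) ^ D * ∫⁻ _ in s, (a : ℝ≥0∞) ^ D ∂measure ς := by
        rw [setLIntegral_const, ENNReal.coe_mul, ENNReal.mul_rpow_of_nonneg _ _ hD, mul_assoc]
    _ ≤ (q : ℝ≥0∞) ^ D * ∫⁻ x in s, (c x : ℝ≥0∞) ^ D ∂measure ς := by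
        gcongr _ * ?_
        refine setLIntegral_mono' hs fun x hx => ?_
        gcongr
        exact (hca hx).1

theorem lintegral_le_rpow_mul_measure_image (h : IsScaleGauge D ς) (hs : MeasurableSet s)
    (hΦ : IsNearSimilarityOn q Φ c s) :
    ∫⁻ x in s, (c x : ℝ≥0∞) ^ D ∂measure ς ≤ (q : ℝ≥0∞) ^ D * measure ς (Φ '' s) := by
  have hD := h.dim_nonneg
  obtain ⟨a, ha, hbil, hca⟩ := hΦ
  calc ∫⁻ x in s, (c x : ℝ≥0∞) ^ D ∂measure ς
      ≤ ∫⁻ _ in s, ((q * a : ℝ≥0) : ℝ≥0∞) ^ D ∂measure ς := by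
        refine setLIntegral_mono' hs fun x hx => ?_
        gcongr
        exact (hca hx).2
    _ = (q : ℝ≥0∞) ^ D * ((a : ℝ≥0∞) ^ D * measure ς s) := by
        rw [setLIntegral_const, ENNReal.coe_mul, ENNReal.mul_rpow_of_nonneg _ _ hD, mul_assoc]
    _ ≤ (q : ℝ≥0∞) ^ D * measure ς (Φ '' s) := by
        gcongr
        exact h.le_measure_image ha hbil.mul_edist_le

theorem measure_image_eq_lintegral [PolishSpace X] (h : IsScaleGauge D ς)
    (hdil : HasDilationOn Φ c s) (hs : MeasurableSet s) (hinj : InjOn Φ s) (hc : Measurable c)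
    (hpos : ∀ x ∈ s, 0 < c x) :
    measure ς (Φ '' s) = ∫⁻ x in s, (c x : ℝ≥0∞) ^ D ∂measure ς := by
  have compare : ∀ q : ℝ≥0, 1 < q →
      measure ς (Φ '' s) ≤ (q : ℝ≥0∞) ^ D * ∫⁻ x in s, (c x : ℝ≥0∞) ^ D ∂measure ς ∧
        ∫⁻ x in s, (c x : ℝ≥0∞) ^ D ∂measure ς ≤ (q : ℝ≥0∞) ^ D * measure ς (Φ '' s) := by
    intro q hq
    obtain ⟨T, hTm, hTd, rfl, hT⟩ := hdil.exists_partition_isNearSimilarityOn hs hc hpos hq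
    have hTs : ∀ i, T i ⊆ ⋃ i, T i := subset_iUnion T
    have himage : measure ς (Φ '' ⋃ i, T i) = ∑' i, measure ς (Φ '' T i) := by
      rw [image_iUnion, measure_iUnion fun i j hij => (hTd hij).image hinj (hTs i) (hTs j)]
      exact fun i => (hTm i).image_of_continuousOn_injOn (hdil.continuousOn.mono (hTs i))
        (hinj.mono (hTs i))
    rw [himage, lintegral_iUnion hTm hTd, ← ENNReal.tsum_mul_left, ← ENNReal.tsum_mul_left]
    exact ⟨ENNReal.tsum_le_tsum fun i =>
        h.measure_image_le_rpow_mul_lintegral (zero_lt_one.trans hq) (hTm i) (hT i),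
      ENNReal.tsum_le_tsum fun i => h.lintegral_le_rpow_mul_measure_image (hTm i) (hT i)⟩
  exact le_antisymm (le_of_forall_one_lt_le_rpow_mul fun q hq => (compare q hq).1)
    (le_of_forall_one_lt_le_rpow_mul fun q hq => (compare q hq).2)

end IsScaleGauge

section ChangeOfVariables

variable {X Y : Type*} [MeasurableSpace X] [MeasurableSpace Y] {μ : Measure X} {ν : Measure Y}
  {Φ : X → Y} {ρ : X → ℝ≥0} {s : Set X}

theorem map_comap_withDensity_eq_restrict_image (hs : MeasurableSet s)
    (hΦ : Measurable (s.domRestrict Φ))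
    (hν : ∀ t ⊆ s, MeasurableSet t → ν (Φ '' t) = ∫⁻ x in t, ρ x ∂μ) :
    Measure.map (s.domRestrict Φ) (Measure.comap (↑) (μ.withDensity fun x => ρ x)) =
      ν.restrict (Φ '' s) := by
  ext B hB
  have hm : MeasurableSet ((↑) '' (s.domRestrict Φ ⁻¹' B) : Set X) := hs.subtype_image (hΦ hB)
  rw [Measure.map_apply hΦ hB, (MeasurableEmbedding.subtype_coe hs).comap_apply,
    withDensity_apply _ hm, Measure.restrict_apply hB, ← hν _ (Subtype.coe_image_subset s _) hm,
    image_image]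
  change ν (s.domRestrict Φ '' _) = _
  rw [image_preimage_eq_inter_range, range_domRestrict]

variable {F : Type*} [NormedAddCommGroup F] [NormedSpace ℝ F]

theorem integrableOn_image_iff (hs : MeasurableSet s) (hΦ : MeasurableEmbedding (s.domRestrict Φ))
    (hρ : Measurable ρ) (hν : ∀ t ⊆ s, MeasurableSet t → ν (Φ '' t) = ∫⁻ x in t, ρ x ∂μ)
    (f : Y → F) : IntegrableOn f (Φ '' s) ν ↔ IntegrableOn (fun x => ρ x • f (Φ x)) s μ := by
  rw [IntegrableOn, ← map_comap_withDensity_eq_restrict_image hs hΦ.measurable hν,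
    hΦ.integrable_map_iff, Set.domRestrict_eq, ← comp_assoc,
    ← (MeasurableEmbedding.subtype_coe hs).integrable_map_iff, map_comap_subtype_coe hs,
    restrict_withDensity hs, integrable_withDensity_iff_integrable_smul₀ hρ.aemeasurable]
  rfl

theorem setIntegral_image_eq (hs : MeasurableSet s) (hΦ : MeasurableEmbedding (s.domRestrict Φ))
    (hρ : Measurable ρ) (hν : ∀ t ⊆ s, MeasurableSet t → ν (Φ '' t) = ∫⁻ x in t, ρ x ∂μ)
    (f : Y → F) : ∫ y in Φ '' s, f y ∂ν = ∫ x in s, ρ x • f (Φ x) ∂μ := by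
  rw [← map_comap_withDensity_eq_restrict_image hs hΦ.measurable hν, hΦ.integral_map]
  simp only [domRestrict_apply]
  rw [← (MeasurableEmbedding.subtype_coe hs).integral_map (g := fun x : X => f (Φ x)),
    map_comap_subtype_coe hs, setIntegral_withDensity_eq_setIntegral_smul₀ hρ.aemeasurable _ hs]

end ChangeOfVariables

namespace IsScaleGauge

variable {X Y : Type*} [MetricSpace X] [MeasurableSpace X] [BorelSpace X] [PolishSpace X]
  [MetricSpace Y] [MeasurableSpace Y] [BorelSpace Y] {Φ : X → Y} {c : X → ℝ≥0} {s : Set X}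
  {D : ℝ} {ς : ℝ≥0∞ → ℝ≥0∞} {F : Type*} [NormedAddCommGroup F] [NormedSpace ℝ F]

theorem measure_image_eq_lintegral_of_subset (h : IsScaleGauge D ς) (hdil : HasDilationOn Φ c s)
    (hinj : InjOn Φ s) (hc : Measurable c) (hpos : ∀ x ∈ s, 0 < c x) :
    ∀ t ⊆ s, MeasurableSet t →
      measure ς (Φ '' t) = ∫⁻ x in t, ((c x ^ D : ℝ≥0) : ℝ≥0∞) ∂measure ς := fun t hts ht => by
  simpa only [ENNReal.coe_rpow_of_nonneg _ h.dim_nonneg] using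
    h.measure_image_eq_lintegral (hdil.mono hts) ht (hinj.mono hts) hc fun x hx => hpos x (hts hx)

theorem integrableOn_image_iff (h : IsScaleGauge D ς) (hdil : HasDilationOn Φ c s)
    (hs : MeasurableSet s) (hinj : InjOn Φ s) (hc : Measurable c) (hpos : ∀ x ∈ s, 0 < c x)
    (f : Y → F) :
    IntegrableOn f (Φ '' s) (measure ς) ↔
      IntegrableOn (fun x => (c x ^ D) • f (Φ x)) s (measure ς) :=
  GenHausdorff.integrableOn_image_iff hs (hdil.continuousOn.measurableEmbedding hs hinj)
    (hc.pow_const D) (h.measure_image_eq_lintegral_of_subset hdil hinj hc hpos) f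

theorem setIntegral_image_eq (h : IsScaleGauge D ς) (hdil : HasDilationOn Φ c s)
    (hs : MeasurableSet s) (hinj : InjOn Φ s) (hc : Measurable c) (hpos : ∀ x ∈ s, 0 < c x)
    (f : Y → F) :
    ∫ y in Φ '' s, f y ∂measure ς = ∫ x in s, (c x ^ D) • f (Φ x) ∂measure ς :=
  GenHausdorff.setIntegral_image_eq hs (hdil.continuousOn.measurableEmbedding hs hinj)
    (hc.pow_const D) (h.measure_image_eq_lintegral_of_subset hdil hinj hc hpos) f

end IsScaleGauge

theorem hasDilationOn_of_hasFDerivWithinAt {𝕜 E G : Type*} [NontriviallyNormedField 𝕜]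
    [NormedAddCommGroup E] [NormedSpace 𝕜 E] [NormedAddCommGroup G] [NormedSpace 𝕜 G]
    {Φ : E → G} {L : E → E →L[𝕜] G} {c : E → ℝ≥0} {s : Set E}
    (hΦ : ∀ x ∈ s, HasFDerivWithinAt Φ (L x) s x) (hL : ∀ x ∈ s, ∀ v, ‖L x v‖ = c x * ‖v‖) :
    HasDilationOn Φ c s := by
  intro x hx
  have herr := hasFDerivWithinAt_iff_tendsto.1 ((hΦ x hx).mono (sdiff_subset : s \ {x} ⊆ s))
  rw [← NNReal.tendsto_coe, tendsto_iff_dist_tendsto_zero]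
  refine squeeze_zero' (.of_forall fun y => dist_nonneg) ?_ herr
  filter_upwards [self_mem_nhdsWithin] with y hy
  have hpos : 0 < ‖y - x‖ := norm_pos_iff.2 (sub_ne_zero.2 hy.2)
  calc dist ((nndist (Φ x) (Φ y) / nndist x y : ℝ≥0) : ℝ) (c x)
      = |‖y - x‖⁻¹ * (‖Φ y - Φ x‖ - ‖L x (y - x)‖)| := by
        rw [Real.dist_eq, NNReal.coe_div, coe_nndist, coe_nndist, dist_comm (Φ x), dist_comm x,
          dist_eq_norm, dist_eq_norm, hL x hx]
        congr 1
        field_simp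
    _ ≤ ‖y - x‖⁻¹ * ‖Φ y - Φ x - L x (y - x)‖ := by
        rw [abs_mul, abs_of_pos (inv_pos.2 hpos)]
        gcongr
        exact abs_norm_sub_norm_le _ _

section RootAbsDet

/-- The `n`-th root of the absolute value of the determinant of an endomorphism of a space of
dimension `n`, which is the norm of the endomorphism if that is conformal. -/
def rootAbsDet {E : Type*} [NormedAddCommGroup E] [NormedSpace ℝ E] (L : E →L[ℝ] E) : ℝ≥0 :=
  ‖L.det‖₊ ^ (1 / (finrank ℝ E : ℝ))

variable {E : Type*} [NormedAddCommGroup E]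

theorem measurable_rootAbsDet [NormedSpace ℝ E] :
    Measurable (rootAbsDet : (E →L[ℝ] E) → ℝ≥0) :=
  ContinuousLinearMap.continuous_det.measurable.nnnorm.pow_const _

variable [InnerProductSpace ℝ E] [FiniteDimensional ℝ E] [Nontrivial E] {L : E →L[ℝ] E}

theorem norm_apply_eq_rootAbsDet_mul (hL : IsConformalMap L) (v : E) :
    ‖L v‖ = rootAbsDet L * ‖v‖ := by
  obtain ⟨k, -, li, rfl⟩ := hL
  have hdet_isometry : |LinearMap.det li.toLinearMap| = 1 := by
    rw [← LinearMap.normDet_eq_abs_det, li.normDet_eq_one]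
  have hdet : |(k • li.toContinuousLinearMap).det| = |k| ^ finrank ℝ E := by
    change |LinearMap.det (k • li.toLinearMap)| = _
    rw [LinearMap.det_smul, abs_mul, hdet_isometry, abs_pow, mul_one]
  rw [rootAbsDet, NNReal.coe_rpow, coe_nnnorm, Real.norm_eq_abs, hdet, one_div,
    Real.pow_rpow_inv_natCast (abs_nonneg k) finrank_pos.ne']
  simp [norm_smul]

theorem rootAbsDet_pos (hL : IsConformalMap L) : 0 < rootAbsDet L := by
  obtain ⟨v, hv⟩ := exists_ne (0 : E)
  have hLv : 0 < ‖L v‖ := norm_pos_iff.2 fun h0 => hv (hL.injective (h0.trans (map_zero L).symm))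
  rw [norm_apply_eq_rootAbsDet_mul hL] at hLv
  exact_mod_cast pos_of_mul_pos_left hLv (norm_nonneg v)

end RootAbsDet

end GenHausdorff

end

open GenHausdorff in
theorem proposition2_general {E : Type*} [NormedAddCommGroup E] [InnerProductSpace ℝ E]
    [FiniteDimensional ℝ E] [Nontrivial E] [MeasurableSpace E] [BorelSpace E] {D : ℝ}
    {ζ : ℝ≥0∞ → ℝ≥0∞} (hζ : ζ ∈ scaleClass D) {O' O : Set E} (hO' : MeasurableSet O') {Φ : E → E}
    (hΦ : IsConformalOnto Φ O' O) {F : Type*} [NormedAddCommGroup F] [NormedSpace ℝ F]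
    [CompleteSpace F] {f : E → F} (hf : IntegrableOn f O (measure ζ)) :
    IntegrableOn (fun x => ((|(fderiv ℝ Φ x).det| ^ (1 / (finrank ℝ E : ℝ))) ^ D) • f (Φ x)) O'
        (measure ζ) ∧
      ∫ y in O, f y ∂measure ζ =
        ∫ x in O', ((|(fderiv ℝ Φ x).det| ^ (1 / (finrank ℝ E : ℝ))) ^ D) • f (Φ x) ∂measure ζ := by
  obtain ⟨ς, hς, hζς⟩ := hζ
  obtain rfl : Φ '' O' = O := hΦ.bijOn.image_eq
  have hconf : ∀ x ∈ O', IsConformalMap (fderiv ℝ Φ x) := fun x hx =>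
    conformalAt_iff_isConformalMap_fderiv.1 (hΦ.conformalAt x hx)
  have hdil : HasDilationOn Φ (fun x => rootAbsDet (fderiv ℝ Φ x)) O' :=
    hasDilationOn_of_hasFDerivWithinAt
      (fun x hx => (hΦ.conformalAt x hx).differentiableAt.hasFDerivAt.hasFDerivWithinAt)
      fun x hx => norm_apply_eq_rootAbsDet_mul (hconf x hx)
  have hmeas : Measurable fun x => rootAbsDet (fderiv ℝ Φ x) :=
    measurable_rootAbsDet.comp (measurable_fderiv ℝ Φ)
  have hpos : ∀ x ∈ O', 0 < rootAbsDet (fderiv ℝ Φ x) := fun x hx => rootAbsDet_pos (hconf x hx)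
  rw [hζς.measure_eq] at hf ⊢
  exact ⟨(hς.integrableOn_image_iff hdil hO' hΦ.bijOn.injOn hmeas hpos f).1 hf,
    hς.setIntegral_image_eq hdil hO' hΦ.bijOn.injOn hmeas hpos f⟩

theorem proposition2 {n : ℕ} (hn : 0 < n) {D : ℝ} (hD : 0 ≤ D)
    {ζ : ℝ≥0∞ → ℝ≥0∞} (hζ : ζ ∈ GenHausdorff.scaleClass D)
    {O' O : Set (EuclideanSpace ℝ (Fin n))} (hO' : IsOpen O') (hO : IsOpen O)
    {Φ : EuclideanSpace ℝ (Fin n) → EuclideanSpace ℝ (Fin n)}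
    (hΦ : GenHausdorff.IsConformalOnto Φ O' O)
    {F : Type*} [NormedAddCommGroup F] [NormedSpace ℝ F] [CompleteSpace F]
    {f : EuclideanSpace ℝ (Fin n) → F}
    (hf : IntegrableOn f O (GenHausdorff.measure ζ)) :
    IntegrableOn (fun x => ((|(fderiv ℝ Φ x).det| ^ (1 / (n : ℝ))) ^ D) • f (Φ x)) O'
        (GenHausdorff.measure ζ) ∧
      ∫ y in O, f y ∂(GenHausdorff.measure ζ) =
        ∫ x in O', ((|(fderiv ℝ Φ x).det| ^ (1 / (n : ℝ))) ^ D) • f (Φ x)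
          ∂(GenHausdorff.measure ζ) := by
  have := Fin.pos_iff_nonempty.1 hn
  simpa only [finrank_euclideanSpace_fin] using proposition2_general hζ hO'.measurableSet hΦ hf
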